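/- Let $r\ge 0$, let $S=\mathbb N^r\setminus\{0\}$, and let $\langle-,-\rangle$ be a skew-symmetric bilinear form on $\mathbb Z^r$ with real (for example integer) values. Let $\mathcal R=\bigoplus_{\gamma\in\mathbb N^r}\mathcal R_\gamma$ be a graded associative $\mathbb Q$-algebra such that $\langle\gamma,\gamma'\rangle=0$ implies $[\mathcal R_\gamma,\mathcal R_{\gamma'}]=0$, and let $A:S\to\mathcal R$ be a map with $A(\gamma)\in\mathcal R_\gamma$ for all $\gamma\in S$. For $\theta\in\mathbb R^r$ and $a\in S$ put $\mu_\theta(a)=\frac{\sum_k\theta_ka_k}{\sum_ka_k}$. Write $a>_\theta b$ if $\mu_\theta(a)>\mu_\theta(b)$ and $a\sim_\theta b$ if $\mu_\theta(a)=\mu_\theta(b)$. Call $\theta$ generic if $a\sim_\theta b$ (with $a,b\in S$) implies $ma=nb$ for some integers $m,n\ge1$. Define $A_\theta:S\to\mathcal R$ recursively by $$A(\gamma)=\sum_{\substack{n\ge1,\ \alpha\in S^n\\ \alpha_1+\dots+\alpha_n=\gamma\\ \alpha_1>_\theta\dots>_\theta\alpha_n}}A_\theta(\alpha_1)\cdots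 A_\theta(\alpha_n),\qquad\gamma\in S,$$ and define the rational DT invariants $\bar A_\theta:S\to\mathcal R$ by $$\bar A_\theta(\gamma)=\sum_{\substack{n\ge1,\ \alpha\in S^n\\ \alpha_1+\dots+\alpha_n=\gamma\\ \alpha_1\sim_\theta\dots\sim_\theta\alpha_n}}\frac{(-1)^{n-1}}{n}\,A_\theta(\alpha_1)\cdots A_\theta(\alpha_n),\qquad\gamma\in S.$$ Let $\gamma\in S$ and let $\theta=\langle-,\gamma\rangle$, that is $\theta_k=\langle e_k,\gamma\rangle$ (this $\theta$ need not be generic). The rational attractor invariant $\bar A_*(\gamma)$ is the common value of $\bar A_{\theta'}(\gamma)$ for all generic $\theta'\in\mathbb R^r$ sufficiently close to $\theta$ (how close may depend on $\gamma$ and $A$; generic $\theta'$ are dense in $\mathbb R^r$). Then $\bar A_*(\gamma)$ is well defined, and $$\bar A_*(\gamma)=\bar A_\theta(\gamma).$$ -/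

import Mathlib

open Filter Topology

/-- The semigroup `S = ℕ^r ∖ {0}`. -/
abbrev DimVec (r : ℕ) : Type := {γ : Fin r → ℕ // γ ≠ 0}

namespace DimVec

variable {r : ℕ}

/-- The total dimension `∑ₖ aₖ`, which is positive on `S`. -/
def size (a : DimVec r) : ℕ := ∑ k, a.1 k

/-- The sum `α₁ + ⋯ + αₙ` of a tuple of elements of `S`, in `ℕ^r` (zero for the empty tuple). -/
def total (α : List (DimVec r)) : Fin r → ℕ := (α.map Subtype.val).sum

/-- `γ` regarded as an element of the lattice `ℤ^r`. -/
def toLattice (γ : Fin r → ℕ) : Fin r → ℤ := fun k => (γ k : ℤ)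

/-- Proportionality `a ∥ b`: `m a = n b` for some `m, n ≥ 1`. -/
def Proportional (a b : DimVec r) : Prop :=
  ∃ m n : ℕ, 1 ≤ m ∧ 1 ≤ n ∧ m • a.1 = n • b.1

theorem size_pos (a : DimVec r) : 0 < a.size := by
  by_contra h
  apply a.2
  funext k
  have h0 : ∑ k, a.1 k = 0 := by simpa [size] using h
  exact (Finset.sum_eq_zero_iff.mp h0) k (Finset.mem_univ k)

theorem sum_total (α : List (DimVec r)) : ∑ k, total α k = (α.map size).sum := by
  induction α with
  | nil => simp [total]
  | cons a l ih =>
    have h : total (a :: l) = a.1 + total l := by simp [total]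
    rw [h]
    simp [Finset.sum_add_distrib, ih, size]

theorem le_total {α : List (DimVec r)} {a : DimVec r} (h : a ∈ α) : a.1 ≤ total α :=
  List.single_le_sum (fun _ _ => zero_le) _ (List.mem_map_of_mem h)

theorem length_le (α : List (DimVec r)) : α.length ≤ (α.map size).sum := by
  induction α with
  | nil => simp
  | cons a l ih =>
    have := a.size_pos
    simp only [List.length_cons, List.map_cons, List.sum_cons]
    omega

/-- Every element of `S` is a sum of elements of `S` in only finitely many ways. -/
theorem finite_total (γ : Fin r → ℕ) : {α : List (DimVec r) | total α = γ}.Finite := by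
  have hT : {a : DimVec r | a.1 ≤ γ}.Finite :=
    Set.Finite.preimage (f := Subtype.val) (Subtype.val_injective.injOn) (Set.finite_Iic γ)
  have : Finite {a : DimVec r // a.1 ≤ γ} := hT
  refine ((List.finite_length_le {a : DimVec r // a.1 ≤ γ} (∑ k, γ k)).image
    (List.map Subtype.val)).subset ?_
  rintro α rfl
  refine ⟨α.attach.map (fun a => ⟨a.1, le_total a.2⟩), ?_, ?_⟩
  · simp only [Set.mem_ofPred_eq, List.length_map, List.length_attach]
    rw [sum_total]
    exact length_le α
  · simpa [List.map_map, Function.comp_def] using List.attach_map_subtype_val α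

/-- The finite set of tuples `(α₁, …, αₙ) ∈ Sⁿ`, `n ≥ 1`, with `α₁ + ⋯ + αₙ = γ`. -/
noncomputable def decomp (γ : DimVec r) : Finset (List (DimVec r)) :=
  (finite_total γ.1).toFinset

theorem mem_decomp {γ : DimVec r} {α : List (DimVec r)} : α ∈ decomp γ ↔ total α = γ.1 := by
  simp [decomp]

theorem sum_size_of_mem_decomp {γ : DimVec r} {α : List (DimVec r)} (h : α ∈ decomp γ) :
    (α.map size).sum = γ.size := by
  rw [← sum_total, mem_decomp.mp h, size]

/-- In a decomposition into at least two elements of `S`, every element is strictly smaller. -/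
theorem size_lt_of_mem {γ : DimVec r} {α : List (DimVec r)} (h : α ∈ decomp γ)
    (h2 : 2 ≤ α.length) {a : DimVec r} (ha : a ∈ α) : a.size < γ.size := by
  obtain ⟨l₁, l₂, rfl⟩ := List.append_of_mem ha
  have h3 := sum_size_of_mem_decomp h
  have h4 := length_le l₁
  have h5 := length_le l₂
  simp only [List.map_append, List.map_cons, List.sum_append, List.sum_cons,
    List.length_append, List.length_cons] at h3 h2
  omega

theorem singleton_mem_decomp (γ : DimVec r) : [γ] ∈ decomp γ := by
  simp [mem_decomp, total]

theorem eq_singleton {γ : DimVec r} {α : List (DimVec r)} (h : α ∈ decomp γ)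
    (h2 : ¬ 2 ≤ α.length) : α = [γ] := by
  match α, h2 with
  | [], _ => exact absurd (mem_decomp.mp h).symm (by simpa [total] using γ.2)
  | [a], _ =>
    have h' := mem_decomp.mp h
    simp only [total, List.map_cons, List.map_nil, List.sum_cons, List.sum_nil, add_zero] at h'
    rw [Subtype.ext h']
  | _ :: _ :: _, h2 => simp at h2

/-- The slope `μ_θ(a) = (∑ₖ θₖ aₖ) / (∑ₖ aₖ)`.  The weak stability on `S` defined by `θ` is
`a ≤_θ b ↔ slope θ a ≤ slope θ b`. -/
noncomputable def slope (θ : Fin r → ℝ) (a : DimVec r) : ℝ :=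
  (∑ k, θ k * (a.1 k : ℝ)) / (a.size : ℝ)

/-- `θ` is generic if `a ∼_θ b` implies `a ∥ b`. -/
def IsGeneric (θ : Fin r → ℝ) : Prop :=
  ∀ a b : DimVec r, slope θ a = slope θ b → Proportional a b

/-- Generic stability parameters are dense, so every `θ` has arbitrarily small generic
perturbations. -/
theorem dense_isGeneric : Dense {θ : Fin r → ℝ | IsGeneric θ} := by
  have hset : {θ : Fin r → ℝ | IsGeneric θ} =
      ⋂ p : {p : DimVec r × DimVec r // ¬ Proportional p.1 p.2},
        {θ | slope θ p.1.1 ≠ slope θ p.1.2} := by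
    ext θ
    rw [Set.mem_iInter]
    exact ⟨fun h p he => p.2 (h p.1.1 p.1.2 he), fun h a b he => by
      by_contra hp
      exact h ⟨(a, b), hp⟩ he⟩
  have hcont : ∀ a : DimVec r, Continuous fun θ : Fin r → ℝ => slope θ a := by
    intro a
    unfold slope
    fun_prop
  rw [hset]
  refine dense_iInter_of_isOpen (fun p => isOpen_ne_fun (hcont _) (hcont _)) ?_
  rintro ⟨⟨a, b⟩, hp⟩
  -- some coordinate direction separates the slopes of `a` and `b`
  obtain ⟨k, hk⟩ : ∃ k, (a.1 k : ℝ) / a.size ≠ (b.1 k : ℝ) / b.size := by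
    by_contra! hall
    refine hp ⟨b.size, a.size, b.size_pos, a.size_pos, ?_⟩
    funext k
    have ha : (a.size : ℝ) ≠ 0 := by exact_mod_cast a.size_pos.ne'
    have hb : (b.size : ℝ) ≠ 0 := by exact_mod_cast b.size_pos.ne'
    have h := (div_eq_div_iff ha hb).mp (hall k)
    have h' : a.1 k * b.size = b.1 k * a.size := by exact_mod_cast h
    simp only [Pi.smul_apply, smul_eq_mul]
    rw [mul_comm, h', mul_comm]
  have hadd : ∀ (c : DimVec r) (θ : Fin r → ℝ) (t : ℝ),
      slope (θ + t • Pi.single k 1) c = slope θ c + t * ((c.1 k : ℝ) / c.size) := by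
    intro c θ t
    simp only [slope, Pi.add_apply, Pi.smul_apply, smul_eq_mul, add_mul, Finset.sum_add_distrib,
      add_div]
    congr 1
    rw [Finset.sum_eq_single k]
    · simp [mul_div_assoc]
    · intro j _ hj
      simp [Pi.single_eq_of_ne hj]
    · simp
  intro θ
  by_cases hθ : slope θ a = slope θ b
  · have hpath : Tendsto (fun t : ℝ => θ + t • (Pi.single k 1 : Fin r → ℝ)) (𝓝[≠] 0) (𝓝 θ) := by
      have hc : Continuous fun t : ℝ => θ + t • (Pi.single k 1 : Fin r → ℝ) := by fun_prop
      have := (hc.tendsto 0).mono_left (nhdsWithin_le_nhds (s := {0}ᶜ))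
      simpa using this
    refine mem_closure_of_tendsto hpath ?_
    filter_upwards [self_mem_nhdsWithin] with t ht
    simp only [hadd, hθ, ne_eq, add_right_inj]
    exact fun h => hk (mul_left_cancel₀ ht h)
  · exact subset_closure hθ

section Collections

variable {R : Type*} [Ring R] [Algebra ℚ R]

/-- The action of a rational collection on a 1-collection:
`(F * H)(γ) = ∑_{α₁ + ⋯ + αₙ = γ} F(α) H(α₁) ⋯ H(αₙ)`. -/
noncomputable def act (F : List (DimVec r) → ℚ) (H : DimVec r → R) : DimVec r → R :=
  fun γ => ∑ α ∈ decomp γ, F α • (α.map H).prod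

open Classical in
/-- The Harder-Narasimhan collection `s_θ`: it is `1` if `α₁ >_θ ⋯ >_θ αₙ` and `0` otherwise. -/
noncomputable def hnCol (θ : Fin r → ℝ) (α : List (DimVec r)) : ℚ :=
  if α.Pairwise (fun a b => slope θ b < slope θ a) then 1 else 0

open Classical in
/-- The logarithmic collection `log_θ`: it is `(-1)^(n-1) / n` if `α₁ ∼_θ ⋯ ∼_θ αₙ` and `0`
otherwise. -/
noncomputable def logCol (θ : Fin r → ℝ) (α : List (DimVec r)) : ℚ :=
  if α.Pairwise (fun a b => slope θ a = slope θ b) then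
    (-1) ^ (α.length - 1) / (α.length : ℚ)
  else 0

/-- The stacky DT invariants `A_θ` of a 1-collection `A`, defined recursively by the basic
wall-crossing formula `A(γ) = ∑ A_θ(α₁) ⋯ A_θ(αₙ)`, the sum over all `α₁ + ⋯ + αₙ = γ` with
`α₁ >_θ ⋯ >_θ αₙ`: the summand with `n = 1` is `A_θ(γ)`, and the other ones are subtracted.
See `hnCol_act_stackyDT` and `stackyDT_unique`. -/
noncomputable def stackyDT (A : DimVec r → R) (θ : Fin r → ℝ) (γ : DimVec r) : R :=
  A γ - ∑ α ∈ ((decomp γ).filter (fun α => 2 ≤ α.length)).attach,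
    hnCol θ α.1 • (α.1.attach.map (fun a => stackyDT A θ a.1)).prod
termination_by γ.size
decreasing_by
  have h := Finset.mem_filter.mp α.2
  exact size_lt_of_mem h.1 h.2 a.2

theorem act_hnCol_eq (θ : Fin r → ℝ) (B : DimVec r → R) (γ : DimVec r) :
    act (hnCol θ) B γ = B γ +
      ∑ α ∈ (decomp γ).filter (fun α => 2 ≤ α.length), hnCol θ α • (α.map B).prod := by
  classical
  have h : (decomp γ).filter (fun α => ¬ 2 ≤ α.length) = {[γ]} := by
    ext α
    simp only [Finset.mem_filter, Finset.mem_singleton]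
    constructor
    · rintro ⟨h1, h2⟩
      exact eq_singleton h1 h2
    · rintro rfl
      exact ⟨singleton_mem_decomp γ, by simp⟩
  rw [act, ← Finset.sum_filter_add_sum_filter_not _ (fun α => 2 ≤ α.length), h, add_comm]
  simp [hnCol]

/-- The basic wall-crossing formula `A = s_θ * A_θ`. -/
theorem hnCol_act_stackyDT (A : DimVec r → R) (θ : Fin r → ℝ) :
    act (hnCol θ) (stackyDT A θ) = A := by
  funext γ
  rw [act_hnCol_eq, stackyDT]
  have h : ∀ α : List (DimVec r),
      α.attach.map (fun a => stackyDT A θ a.1) = α.map (stackyDT A θ) := fun α => by simp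
  simp only [h]
  rw [Finset.sum_attach ((decomp γ).filter (fun α => 2 ≤ α.length))
    (fun α => hnCol θ α • (α.map (stackyDT A θ)).prod)]
  abel

/-- The basic wall-crossing formula determines `A_θ`. -/
theorem stackyDT_unique (A B : DimVec r → R) (θ : Fin r → ℝ) (h : act (hnCol θ) B = A) :
    B = stackyDT A θ := by
  have key : ∀ n : ℕ, ∀ γ : DimVec r, γ.size < n → B γ = stackyDT A θ γ := by
    intro n
    induction n with
    | zero => intro γ hγ; omega
    | succ n ih =>
      intro γ hγ
      have h1 := congrFun (h.trans (hnCol_act_stackyDT A θ).symm) γ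
      rw [act_hnCol_eq, act_hnCol_eq] at h1
      have h2 : ∑ α ∈ (decomp γ).filter (fun α => 2 ≤ α.length), hnCol θ α • (α.map B).prod =
          ∑ α ∈ (decomp γ).filter (fun α => 2 ≤ α.length),
            hnCol θ α • (α.map (stackyDT A θ)).prod := by
        refine Finset.sum_congr rfl fun α hα => ?_
        have hα' := Finset.mem_filter.mp hα
        rw [List.map_congr_left fun a ha => ih a (by
          have := size_lt_of_mem hα'.1 hα'.2 ha
          omega)]
      rw [h2] at h1
      exact add_right_cancel h1
  funext γ
  exact key _ γ (Nat.lt_succ_self _)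

/-- The rational DT invariants `Ā_θ = log_θ * A_θ`. -/
noncomputable def rationalDT (A : DimVec r → R) (θ : Fin r → ℝ) : DimVec r → R :=
  act (logCol θ) (stackyDT A θ)

/-- The self-stability `θ = ⟨-, γ⟩`, in coordinates `θₖ = ⟨eₖ, γ⟩`. -/
def selfStability (ω : (Fin r → ℤ) →ₗ[ℤ] (Fin r → ℤ) →ₗ[ℤ] ℝ) (γ : DimVec r) : Fin r → ℝ :=
  fun k => ω (Pi.single k 1) (toLattice γ.1)

/-- `x` is the value `Ā_θ'(γ)` for all sufficiently small generic perturbations `θ'` of the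
self-stability `θ = ⟨-, γ⟩`. -/
def IsAttractorInvariant (A : DimVec r → R) (ω : (Fin r → ℤ) →ₗ[ℤ] (Fin r → ℤ) →ₗ[ℤ] ℝ)
    (γ : DimVec r) (x : R) : Prop :=
  ∀ᶠ θ' in 𝓝 (selfStability ω γ), IsGeneric θ' → rationalDT A θ' γ = x

theorem IsAttractorInvariant.unique {A : DimVec r → R}
    {ω : (Fin r → ℤ) →ₗ[ℤ] (Fin r → ℤ) →ₗ[ℤ] ℝ} {γ : DimVec r} {x y : R}
    (hx : IsAttractorInvariant A ω γ x) (hy : IsAttractorInvariant A ω γ y) : x = y := by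
  have hf : ∃ᶠ θ' in 𝓝 (selfStability ω γ), IsGeneric θ' :=
    mem_closure_iff_frequently.mp (dense_isGeneric _)
  obtain ⟨θ', hg, h1, h2⟩ := (hf.and_eventually (Filter.Eventually.and hx hy)).exists
  exact (h1 hg).symm.trans (h2 hg)

open Classical in
/-- The attractor invariant `Ā_*(γ) = Ā_θ'(γ)`, for a sufficiently small generic perturbation
`θ'` of the self-stability `θ = ⟨-, γ⟩`.  It is the unique `x` with `IsAttractorInvariant A ω γ x`;
the value `0` is a placeholder in case `Ā_θ'(γ)` depends on the choice of `θ'`. -/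
noncomputable def attractorInvariant (A : DimVec r → R)
    (ω : (Fin r → ℤ) →ₗ[ℤ] (Fin r → ℤ) →ₗ[ℤ] ℝ) (γ : DimVec r) : R :=
  if h : ∃ x, IsAttractorInvariant A ω γ x then h.choose else 0

end Collections

end DimVec

/-! The generating series `1 + ∑ A_θ(b) t^b` over the `b` of a fixed slope are the factors of the
Harder–Narasimhan product of `A`. A parameter `θ'` near `θ` separates all the slopes below `γ` that
`θ` separates, so, by uniqueness of the recursion, each factor for `θ` is, up to degree `γ`, the
ordered product of the factors for those `θ'`-slopes into which its slope splits.

On homogeneous series supported in the slope of `γ`, the coefficient at `t^γ` is a trace: if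
`b + b' = γ` and all three have the same slope for `θ = ⟨-, γ⟩`, then `⟨b, b'⟩ = ⟨b, γ⟩ = 0`, so
`R_b` and `R_b'` commute. For the Euler derivation `D`, the equality
`tr ((f g)⁻¹ D (f g)) = tr (f⁻¹ D f) + tr (g⁻¹ D g)` therefore makes the `t^γ`-coefficient of the
logarithm additive on products. That coefficient is a rational DT invariant of `γ`, and only the
factor of the `θ'`-slope of `γ` contributes to it. -/

section EulerDerivation

open MvPowerSeries

variable {σ R : Type*}

/-- The Euler derivation of power series, which multiplies the monomials of total degree `n`
by `n`. -/
noncomputable def eulerDeriv [Semiring R] : MvPowerSeries σ R →+ MvPowerSeries σ R where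
  toFun f a := a.degree • coeff a f
  map_zero' := by ext; exact smul_zero _
  map_add' _ _ := by ext; exact smul_add _ _ _

theorem coeff_eulerDeriv [Semiring R] (a : σ →₀ ℕ) (f : MvPowerSeries σ R) :
    coeff a (eulerDeriv f) = a.degree • coeff a f := rfl

theorem constantCoeff_eulerDeriv [Semiring R] (f : MvPowerSeries σ R) :
    constantCoeff (eulerDeriv f) = 0 := by
  rw [← coeff_zero_eq_constantCoeff_apply, coeff_eulerDeriv, map_zero, zero_smul]

theorem eulerDeriv_mul [Semiring R] (f g : MvPowerSeries σ R) :
    eulerDeriv (f * g) = eulerDeriv f * g + f * eulerDeriv g := by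
  classical
  ext a
  simp only [map_add, coeff_eulerDeriv, coeff_mul, Finset.smul_sum, ← Finset.sum_add_distrib]
  refine Finset.sum_congr rfl fun x hx => ?_
  rw [← Finset.HasAntidiagonal.mem_antidiagonal.mp hx, map_add, add_smul,
    smul_mul_assoc, mul_smul_comm]

theorem coeff_mul_pow_mul_eq_zero [Semiring R] {g : MvPowerSeries σ R}
    (hg : constantCoeff g = 0) {c : σ →₀ ℕ} {n : ℕ} (hc : c.degree < n) (x y : MvPowerSeries σ R) :
    coeff c (x * g ^ n * y) = 0 := by
  refine coeff_of_lt_order ?_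
  calc (c.degree : ℕ∞) < n := by exact_mod_cast hc
    _ ≤ (g ^ n).order := le_order_pow_of_constantCoeff_eq_zero n hg
    _ ≤ (x * g ^ n).order := le_add_self.trans le_order_mul
    _ ≤ (x * g ^ n * y).order := le_self_add.trans le_order_mul

variable [Ring R]

theorem eulerDeriv_one_sub (f : MvPowerSeries σ R) : eulerDeriv (1 - f) = -eulerDeriv f := by
  have h : eulerDeriv (1 : MvPowerSeries σ R) = 0 := by
    simpa using eulerDeriv_mul (1 : MvPowerSeries σ R) 1
  rw [map_sub, h, zero_sub]

/-- The geometric series `f⁻¹ = ∑ (1 - f)ⁿ`, truncated where it does not affect degree `c`. -/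
theorem coeff_invOfUnit_one_mul {f : MvPowerSeries σ R} (hf : constantCoeff f = 1)
    (c : σ →₀ ℕ) (y : MvPowerSeries σ R) :
    coeff c (invOfUnit f 1 * y) =
      ∑ n ∈ Finset.range (c.degree + 1), coeff c ((1 - f) ^ n * y) := by
  have hgeom : ∑ n ∈ Finset.range (c.degree + 1), (1 - f) ^ n =
      invOfUnit f 1 - invOfUnit f 1 * (1 - f) ^ (c.degree + 1) := by
    rw [← mul_one_sub, ← mul_neg_geom_sum, sub_sub_cancel, ← mul_assoc, invOfUnit_mul f 1 hf,
      one_mul]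
  have hrem : coeff c (invOfUnit f 1 * (1 - f) ^ (c.degree + 1) * y) = 0 :=
    coeff_mul_pow_mul_eq_zero (by rw [map_sub, map_one, hf, sub_self]) c.degree.lt_succ_self _ _
  rw [← map_sum, ← Finset.sum_mul, hgeom, sub_mul, map_sub, hrem, sub_zero]

theorem invOfUnit_one_mul {f g : MvPowerSeries σ R} (hf : constantCoeff f = 1)
    (hg : constantCoeff g = 1) :
    invOfUnit (f * g) 1 = invOfUnit g 1 * invOfUnit f 1 := by
  have hfg : constantCoeff (f * g) = 1 := by rw [map_mul, hf, hg, one_mul]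
  refine left_inv_eq_right_inv (invOfUnit_mul _ 1 hfg) ?_
  rw [mul_assoc, ← mul_assoc g, mul_invOfUnit g 1 hg, one_mul, mul_invOfUnit f 1 hf]

/-- A subring of power series stable under the Euler derivation and under inverting series with
constant term `1`, on which taking the coefficient at `c` is a trace. -/
structure IsTracialAt (c : σ →₀ ℕ) (B : Subring (MvPowerSeries σ R)) : Prop where
  eulerDeriv_mem : ∀ f ∈ B, eulerDeriv f ∈ B
  invOfUnit_mem : ∀ f ∈ B, constantCoeff f = 1 → invOfUnit f 1 ∈ B
  coeff_mul_comm : ∀ f ∈ B, ∀ g ∈ B, coeff c (f * g) = coeff c (g * f)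

/-- The logarithm `log f = ∑ (-1)ⁿ (f - 1)ⁿ⁺¹ / (n + 1)` of a power series with constant term `1`;
the omitted terms do not contribute to the coefficient at `c`. -/
noncomputable def logSeries [Algebra ℚ R] (f : MvPowerSeries σ R) : MvPowerSeries σ R :=
  fun c => ∑ n ∈ Finset.range (c.degree + 1),
    ((-1) ^ n / ((n + 1 : ℕ) : ℚ)) • coeff c ((f - 1) ^ (n + 1))

theorem coeff_logSeries [Algebra ℚ R] (c : σ →₀ ℕ) (f : MvPowerSeries σ R) :
    coeff c (logSeries f) = ∑ n ∈ Finset.range (c.degree + 1),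
      ((-1) ^ n / ((n + 1 : ℕ) : ℚ)) • coeff c ((f - 1) ^ (n + 1)) := rfl

theorem logSeries_one [Algebra ℚ R] : logSeries (1 : MvPowerSeries σ R) = 0 := by
  ext c
  simp [coeff_logSeries]

theorem constantCoeff_logSeries [Algebra ℚ R] {f : MvPowerSeries σ R}
    (hf : constantCoeff f = 1) : constantCoeff (logSeries f) = 0 := by
  rw [← coeff_zero_eq_constantCoeff_apply, coeff_logSeries]
  simp [hf]

namespace IsTracialAt

variable {c : σ →₀ ℕ} {B : Subring (MvPowerSeries σ R)} {f g : MvPowerSeries σ R}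

theorem coeff_pow_mul_eulerDeriv_pow (hB : IsTracialAt c B) (hf : f ∈ B) (m n : ℕ) :
    coeff c (f ^ m * eulerDeriv (f ^ (n + 1))) =
      (n + 1) • coeff c (f ^ (m + n) * eulerDeriv f) := by
  induction n generalizing m with
  | zero => simp
  | succ n ih =>
    have hcycle : coeff c (f ^ m * eulerDeriv (f ^ (n + 1)) * f) =
        coeff c (f ^ (m + 1) * eulerDeriv (f ^ (n + 1))) := by
      rw [hB.coeff_mul_comm _ (B.mul_mem (B.pow_mem hf m)
        (hB.eulerDeriv_mem _ (B.pow_mem hf _))) f hf, pow_succ' f m, mul_assoc]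
    rw [pow_succ f (n + 1), eulerDeriv_mul, mul_add, map_add, ← mul_assoc, ← mul_assoc, ← pow_add,
      hcycle, ih (m + 1), succ_nsmul _ (n + 1), add_right_comm, add_assoc]

theorem degree_smul_coeff_pow (hB : IsTracialAt c B) (hf : f ∈ B) (n : ℕ) :
    c.degree • coeff c (f ^ (n + 1)) = (n + 1) • coeff c (f ^ n * eulerDeriv f) := by
  simpa [coeff_eulerDeriv] using hB.coeff_pow_mul_eulerDeriv_pow hf 0 n

theorem coeff_invOfUnit_mul_eulerDeriv_mul (hB : IsTracialAt c B) (hf : f ∈ B) (hg : g ∈ B)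
    (hf₁ : constantCoeff f = 1) (hg₁ : constantCoeff g = 1) :
    coeff c (invOfUnit (f * g) 1 * eulerDeriv (f * g)) =
      coeff c (invOfUnit f 1 * eulerDeriv f) + coeff c (invOfUnit g 1 * eulerDeriv g) := by
  have hexpand : invOfUnit (f * g) 1 * eulerDeriv (f * g) =
      invOfUnit g 1 * (invOfUnit f 1 * eulerDeriv f * g) + invOfUnit g 1 * eulerDeriv g := by
    rw [invOfUnit_one_mul hf₁ hg₁, eulerDeriv_mul, mul_add, mul_assoc, mul_assoc,
      ← mul_assoc (invOfUnit f 1) f, invOfUnit_mul f 1 hf₁, one_mul, ← mul_assoc (invOfUnit f 1)]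
  have hmem : invOfUnit f 1 * eulerDeriv f * g ∈ B :=
    B.mul_mem (B.mul_mem (hB.invOfUnit_mem f hf hf₁) (hB.eulerDeriv_mem f hf)) hg
  rw [hexpand, map_add, hB.coeff_mul_comm _ (hB.invOfUnit_mem g hg hg₁) _ hmem, mul_assoc,
    mul_invOfUnit g 1 hg₁, mul_one]

variable [Algebra ℚ R]

/-- Under the trace, `D (log f) = f⁻¹ * D f` holds although `f` and `D f` need not commute. -/
theorem degree_smul_coeff_logSeries (hB : IsTracialAt c B) (hf : f ∈ B)
    (hf₁ : constantCoeff f = 1) :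
    c.degree • coeff c (logSeries f) = coeff c (invOfUnit f 1 * eulerDeriv f) := by
  rw [coeff_logSeries, coeff_invOfUnit_one_mul hf₁, Finset.smul_sum]
  refine Finset.sum_congr rfl fun n _ => ?_
  have hn : ((n + 1 : ℕ) : ℚ) ≠ 0 := by positivity
  have hD : eulerDeriv (f - 1) = eulerDeriv f := by
    rw [← neg_sub, map_neg, eulerDeriv_one_sub, neg_neg]
  have hsign : (1 - f) ^ n = (-1 : ℚ) ^ n • (f - 1) ^ n := by
    rw [← smul_pow, neg_one_smul, neg_sub]
  rw [smul_comm, hB.degree_smul_coeff_pow (B.sub_mem hf B.one_mem), hD,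
    ← Nat.cast_smul_eq_nsmul ℚ, smul_smul, div_mul_cancel₀ _ hn, hsign, smul_mul_assoc]
  rfl

theorem coeff_logSeries_mul (hB : IsTracialAt c B) (hf : f ∈ B) (hg : g ∈ B)
    (hf₁ : constantCoeff f = 1) (hg₁ : constantCoeff g = 1) :
    coeff c (logSeries (f * g)) = coeff c (logSeries f) + coeff c (logSeries g) := by
  have hfg₁ : constantCoeff (f * g) = 1 := by rw [map_mul, hf₁, hg₁, one_mul]
  obtain rfl | hc := eq_or_ne c 0
  · simp only [coeff_zero_eq_constantCoeff, constantCoeff_logSeries, hf₁, hg₁, hfg₁, add_zero]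
  · have hdeg : (c.degree : ℚ) ≠ 0 := by
      rwa [Nat.cast_ne_zero, ne_eq, Finsupp.degree_eq_zero_iff]
    refine smul_right_injective R hdeg ?_
    simp only [smul_add, Nat.cast_smul_eq_nsmul]
    rw [hB.degree_smul_coeff_logSeries hf hf₁, hB.degree_smul_coeff_logSeries hg hg₁,
      hB.degree_smul_coeff_logSeries (B.mul_mem hf hg) hfg₁,
      hB.coeff_invOfUnit_mul_eulerDeriv_mul hf hg hf₁ hg₁]

theorem coeff_logSeries_list_prod (hB : IsTracialAt c B) {l : List (MvPowerSeries σ R)}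
    (hl : ∀ f ∈ l, f ∈ B) (hl₁ : ∀ f ∈ l, constantCoeff f = 1) :
    coeff c (logSeries l.prod) = (l.map fun f => coeff c (logSeries f)).sum := by
  induction l with
  | nil => rw [List.prod_nil, logSeries_one, map_zero, List.map_nil, List.sum_nil]
  | cons f l ih =>
    obtain ⟨hf, hl⟩ := List.forall_mem_cons.mp hl
    obtain ⟨hf₁, hl₁⟩ := List.forall_mem_cons.mp hl₁
    have hprod : constantCoeff l.prod = 1 :=
      (MonoidHom.mker (constantCoeff (σ := σ) (R := R))).list_prod_mem hl₁
    rw [List.prod_cons, List.map_cons, List.sum_cons, ← ih hl hl₁,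
      hB.coeff_logSeries_mul hf (B.list_prod_mem hl) hf₁ hprod]

end IsTracialAt

end EulerDerivation

section CoefficientConditions

open MvPowerSeries

variable {σ R S : Type*} [Ring R]

/-- The power series with exponents in a submonoid. -/
def supportedSeries (R : Type*) [Ring R] (P : AddSubmonoid (σ → ℕ)) :
    Subring (MvPowerSeries σ R) where
  carrier := {f | ∀ a : σ →₀ ℕ, ⇑a ∉ P → coeff a f = 0}
  mul_mem' {f g} hf hg a ha := by
    classical
    rw [coeff_mul]
    refine Finset.sum_eq_zero fun x hx => ?_
    by_cases hx₁ : ⇑x.1 ∈ P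
    · have hx₂ : ⇑x.2 ∉ P := fun hx₂ => ha (by
        rw [← Finset.HasAntidiagonal.mem_antidiagonal.mp hx, Finsupp.coe_add]
        exact P.add_mem hx₁ hx₂)
      rw [hg _ hx₂, mul_zero]
    · rw [hf _ hx₁, zero_mul]
  one_mem' a ha := by
    classical
    rw [coeff_one, if_neg]
    rintro rfl
    exact ha P.zero_mem
  add_mem' hf hg a ha := by rw [map_add, hf a ha, hg a ha, add_zero]
  zero_mem' _ _ := rfl
  neg_mem' hf a ha := by rw [map_neg, hf a ha, neg_zero]

/-- The power series whose coefficient at each exponent `a` is homogeneous of degree `a`. -/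
def homogeneousSeries [SetLike S R] [AddSubgroupClass S R] (𝓡 : (σ → ℕ) → S)
    [SetLike.GradedMonoid 𝓡] : Subring (MvPowerSeries σ R) where
  carrier := {f | ∀ a : σ →₀ ℕ, coeff a f ∈ 𝓡 a}
  mul_mem' {f g} hf hg a := by
    classical
    rw [coeff_mul]
    refine sum_mem fun x hx => ?_
    rw [← Finset.HasAntidiagonal.mem_antidiagonal.mp hx]
    exact SetLike.mul_mem_graded (hf x.1) (hg x.2)
  one_mem' a := by
    classical
    rw [coeff_one]
    split_ifs with ha
    · rw [ha]
      exact SetLike.one_mem_graded 𝓡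
    · exact zero_mem _
  add_mem' hf hg a := add_mem (hf a) (hg a)
  zero_mem' _ := zero_mem _
  neg_mem' hf a := neg_mem (hf a)

theorem invOfUnit_one_mem_supportedSeries {P : AddSubmonoid (σ → ℕ)} {f : MvPowerSeries σ R}
    (hf : f ∈ supportedSeries R P) (hf₁ : constantCoeff f = 1) :
    invOfUnit f 1 ∈ supportedSeries R P := by
  intro a ha
  rw [← mul_one (invOfUnit f 1), coeff_invOfUnit_one_mul hf₁]
  exact Finset.sum_eq_zero fun n _ =>
    mul_mem (pow_mem (sub_mem (one_mem _) hf) n) (one_mem (supportedSeries R P)) a ha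

variable [SetLike S R] [AddSubgroupClass S R] {𝓡 : (σ → ℕ) → S} [SetLike.GradedMonoid 𝓡]

theorem invOfUnit_one_mem_homogeneousSeries {f : MvPowerSeries σ R}
    (hf : f ∈ homogeneousSeries 𝓡) (hf₁ : constantCoeff f = 1) :
    invOfUnit f 1 ∈ homogeneousSeries 𝓡 := by
  intro a
  rw [← mul_one (invOfUnit f 1), coeff_invOfUnit_one_mul hf₁]
  exact sum_mem fun n _ =>
    mul_mem (pow_mem (sub_mem (one_mem _) hf) n) (one_mem (homogeneousSeries 𝓡)) a

/-- The homogeneous power series supported in `P` whose constant term is central, so that only the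
coefficients at nonzero exponents can fail to commute. -/
noncomputable def homogeneousSeriesOn (𝓡 : (σ → ℕ) → S) [SetLike.GradedMonoid 𝓡]
    (P : AddSubmonoid (σ → ℕ)) : Subring (MvPowerSeries σ R) :=
  homogeneousSeries 𝓡 ⊓ supportedSeries R P ⊓ (Subring.center R).comap constantCoeff

theorem coeff_mul_comm_of_mem_homogeneousSeriesOn {P : AddSubmonoid (σ → ℕ)} {c : σ →₀ ℕ}
    (hcomm : ∀ a b : σ →₀ ℕ, a + b = c → a ≠ 0 → b ≠ 0 → ⇑a ∈ P → ⇑b ∈ P →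
      ∀ x ∈ 𝓡 a, ∀ y ∈ 𝓡 b, Commute x y)
    {f g : MvPowerSeries σ R} (hf : f ∈ homogeneousSeriesOn 𝓡 P)
    (hg : g ∈ homogeneousSeriesOn 𝓡 P) : coeff c (f * g) = coeff c (g * f) := by
  classical
  obtain ⟨⟨hf, hfP⟩, hf₀⟩ := hf
  obtain ⟨⟨hg, hgP⟩, hg₀⟩ := hg
  rw [coeff_mul, coeff_mul]
  refine Finset.sum_equiv (Equiv.prodComm _ _) (by simp [add_comm]) fun ⟨a, b⟩ hab => ?_
  change Commute (coeff a f) (coeff b g)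
  obtain rfl | ha := eq_or_ne a 0
  · exact (Subring.mem_center_iff.mp hf₀ _).symm
  obtain rfl | hb := eq_or_ne b 0
  · exact Subring.mem_center_iff.mp hg₀ _
  by_cases haP : ⇑a ∈ P
  · by_cases hbP : ⇑b ∈ P
    · have hab := Finset.HasAntidiagonal.mem_antidiagonal.mp hab
      exact hcomm a b hab ha hb haP hbP _ (hf a) _ (hg b)
    · exact (hgP b hbP).symm ▸ Commute.zero_right _
  · exact (hfP a haP).symm ▸ Commute.zero_left _

theorem isTracialAt_homogeneousSeriesOn {P : AddSubmonoid (σ → ℕ)} {c : σ →₀ ℕ}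
    (hcomm : ∀ a b : σ →₀ ℕ, a + b = c → a ≠ 0 → b ≠ 0 → ⇑a ∈ P → ⇑b ∈ P →
      ∀ x ∈ 𝓡 a, ∀ y ∈ 𝓡 b, Commute x y) :
    IsTracialAt c (homogeneousSeriesOn 𝓡 P) where
  eulerDeriv_mem := by
    rintro f ⟨⟨hf, hP⟩, -⟩
    refine ⟨⟨fun a => nsmul_mem (hf a) _, fun a ha => ?_⟩, ?_⟩
    · rw [coeff_eulerDeriv, hP a ha, smul_zero]
    · change constantCoeff (eulerDeriv f) ∈ Subring.center R
      rw [constantCoeff_eulerDeriv]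
      exact zero_mem _
  invOfUnit_mem := by
    rintro f ⟨⟨hf, hP⟩, -⟩ hf₁
    refine ⟨⟨invOfUnit_one_mem_homogeneousSeries hf hf₁,
      invOfUnit_one_mem_supportedSeries hP hf₁⟩, ?_⟩
    change constantCoeff (invOfUnit f 1) ∈ Subring.center R
    rw [constantCoeff_invOfUnit, inv_one, Units.val_one]
    exact one_mem _
  coeff_mul_comm _ hf _ hg := coeff_mul_comm_of_mem_homogeneousSeriesOn hcomm hf hg

end CoefficientConditions

namespace DimVec

open MvPowerSeries

variable {r : ℕ} {R : Type*}

section Exponents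

/-- The exponent of the monomial `t^γ`. -/
noncomputable def exponent (γ : DimVec r) : Fin r →₀ ℕ := Finsupp.equivFunOnFinite.symm γ.1

theorem coe_exponent (γ : DimVec r) : ⇑γ.exponent = γ.1 := rfl

theorem exponent_ne_zero (γ : DimVec r) : γ.exponent ≠ 0 := fun h => γ.2 (by
  rw [← coe_exponent, h, Finsupp.coe_zero])

theorem exponent_injective : Function.Injective (exponent (r := r)) :=
  Finsupp.equivFunOnFinite.symm.injective.comp Subtype.val_injective

theorem degree_exponent (γ : DimVec r) : γ.exponent.degree = γ.size := Finsupp.degree_eq_sum _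

theorem eq_zero_or_eq_exponent (a : Fin r →₀ ℕ) : a = 0 ∨ ∃ γ : DimVec r, a = γ.exponent := by
  refine or_iff_not_imp_left.mpr fun ha => ⟨⟨a, fun h => ha (DFunLike.coe_injective h)⟩, ?_⟩
  ext
  rfl

end Exponents

section TupleSeries

theorem total_cons (b : DimVec r) (α : List (DimVec r)) : total (b :: α) = b.1 + total α :=
  List.sum_cons

/-- The finite set of tuples in `S` with sum `a`; in contrast to `decomp`, the sum may be zero. -/
noncomputable def tuples (a : Fin r → ℕ) : Finset (List (DimVec r)) := (finite_total a).toFinset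

theorem mem_tuples {a : Fin r → ℕ} {α : List (DimVec r)} : α ∈ tuples a ↔ total α = a := by
  rw [tuples, Set.Finite.mem_toFinset, Set.mem_ofPred_eq]

/-- The generating series `∑ Φ(α) t^(α₁ + ⋯ + αₙ)` of a function `Φ` on the tuples in `S`. -/
noncomputable def tupleSeries [AddCommMonoid R] (Φ : List (DimVec r) → R) :
    MvPowerSeries (Fin r) R :=
  fun a => ∑ α ∈ tuples a, Φ α

theorem coeff_tupleSeries [Semiring R] (Φ : List (DimVec r) → R) (a : Fin r →₀ ℕ) :
    coeff a (tupleSeries Φ) = ∑ α ∈ tuples a, Φ α := rfl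

theorem tupleSeries_add [Semiring R] (Φ Ψ : List (DimVec r) → R) :
    tupleSeries (Φ + Ψ) = tupleSeries Φ + tupleSeries Ψ := by
  ext a
  simp only [map_add, coeff_tupleSeries, Pi.add_apply, Finset.sum_add_distrib]

variable [Semiring R]

/-- The generating series `∑ H(γ) t^γ` of a 1-collection, with constant term zero. -/
noncomputable def collectionSeries (H : DimVec r → R) : MvPowerSeries (Fin r) R :=
  fun a => if h : ⇑a = 0 then 0 else H ⟨⇑a, h⟩

theorem constantCoeff_collectionSeries (H : DimVec r → R) :
    constantCoeff (collectionSeries H) = 0 := dif_pos rfl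

theorem coeff_exponent_collectionSeries (H : DimVec r → R) (γ : DimVec r) :
    coeff γ.exponent (collectionSeries H) = H γ := dif_neg γ.2

/-- The function `(α₁, …, αₙ) ↦ H(α₁) Φ(α₂, …, αₙ)` on the nonempty tuples. -/
def consTuple (H : DimVec r → R) (Φ : List (DimVec r) → R) : List (DimVec r) → R
  | [] => 0
  | b :: α => H b * Φ α

theorem tupleSeries_eq_one {Φ : List (DimVec r) → R} (hnil : Φ [] = 1)
    (hcons : ∀ b α, Φ (b :: α) = 0) : tupleSeries Φ = 1 := by
  classical
  ext a
  have hmem : [] ∈ tuples a ↔ a = 0 := by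
    rw [mem_tuples, eq_comm, ← Finsupp.coe_eq_zero]
    rfl
  have hΦ : Φ = fun α => if α = [] then 1 else 0 := by
    funext α
    cases α with
    | nil => rw [hnil, if_pos rfl]
    | cons b α => rw [hcons, if_neg (List.cons_ne_nil b α)]
  simp only [hΦ, coeff_tupleSeries, coeff_one, Finset.sum_ite_eq', hmem]

theorem collectionSeries_mul_tupleSeries (H : DimVec r → R) (Φ : List (DimVec r) → R) :
    collectionSeries H * tupleSeries Φ = tupleSeries (consTuple H Φ) := by
  classical
  ext a
  simp only [coeff_mul, coeff_tupleSeries, Finset.mul_sum]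
  rw [Finset.sum_sigma']
  symm
  -- Both summands vanish at `[]`, whose image only has to keep `split` injective.
  let split : List (DimVec r) → (_ : (Fin r →₀ ℕ) × (Fin r →₀ ℕ)) × List (DimVec r)
    | [] => ⟨(0, 0), []⟩
    | b :: α => ⟨(b.exponent, Finsupp.equivFunOnFinite.symm (total α)), α⟩
  refine Finset.sum_of_injOn split ?_ ?_ ?_ ?_
  · rintro (_ | ⟨b, α⟩) - (_ | ⟨b', α'⟩) - h
    · rfl
    · exact absurd (congrArg (·.1.1) h).symm b'.exponent_ne_zero
    · exact absurd (congrArg (·.1.1) h) b.exponent_ne_zero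
    · exact congrArg₂ _ (exponent_injective (congrArg (·.1.1) h)) (congrArg (·.2) h)
  · rintro (_ | ⟨b, α⟩) hα <;>
      simp only [Finset.mem_coe, Finset.mem_sigma, Finset.HasAntidiagonal.mem_antidiagonal,
        mem_tuples, total_cons, split] at hα ⊢
    · exact ⟨DFunLike.coe_injective hα, rfl⟩
    · exact ⟨DFunLike.coe_injective hα, rfl⟩
  · rintro ⟨⟨x, y⟩, α⟩ hα hsplit
    simp only [Finset.mem_sigma, Finset.HasAntidiagonal.mem_antidiagonal, mem_tuples] at hα
    obtain ⟨rfl, hα⟩ := hα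
    obtain rfl | ⟨b, rfl⟩ := eq_zero_or_eq_exponent x
    · rw [coeff_zero_eq_constantCoeff_apply, constantCoeff_collectionSeries, zero_mul]
    · refine absurd ⟨b :: α, ?_, ?_⟩ hsplit
      · rw [Finset.mem_coe, mem_tuples, total_cons, hα]
        rfl
      · simp only [split, hα, Finsupp.equivFunOnFinite_symm_coe]
  · rintro (_ | ⟨b, α⟩) -
    · exact (zero_mul _).symm.trans (congrArg (· * Φ []) (constantCoeff_collectionSeries H).symm)
    · exact congrArg (· * Φ α) (coeff_exponent_collectionSeries H b).symm

theorem collectionSeries_pow (H : DimVec r → R) (n : ℕ) :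
    collectionSeries H ^ n =
      tupleSeries fun α => if α.length = n then (α.map H).prod else 0 := by
  induction n with
  | zero =>
    rw [pow_zero, tupleSeries_eq_one (by simp) (by simp)]
  | succ n ih =>
    rw [pow_succ', ih, collectionSeries_mul_tupleSeries]
    congr 1
    funext α
    cases α <;> simp [consTuple]

theorem prod_map_indicator (K : Set (DimVec r)) [DecidablePred (· ∈ K)] (H : DimVec r → R)
    (α : List (DimVec r)) :
    (α.map (K.indicator H)).prod = if ∀ b ∈ α, b ∈ K then (α.map H).prod else 0 := by
  split_ifs with h
  · rw [List.map_congr_left fun b hb => Set.indicator_of_mem (h b hb) H]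
  · push Not at h
    obtain ⟨b, hb, hbK⟩ := h
    exact List.prod_eq_zero (List.mem_map.mpr ⟨b, hb, Set.indicator_of_notMem hbK H⟩)

end TupleSeries

section SlopeFactors

theorem sublist_iff_of_sortedGT {ι : Type*} [LinearOrder ι] {l L : List ι} (hL : L.SortedGT) :
    l.Sublist L ↔ l.SortedGT ∧ l ⊆ L := by
  refine ⟨fun h => ⟨(hL.pairwise.sublist h).sortedGT, h.subset⟩, fun ⟨hl, hsub⟩ => ?_⟩
  exact List.sublist_of_subperm_of_sortedGE (List.subperm_of_subset hl.nodup hsub)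
    hl.sortedGE hL.sortedGE

section Semiring

variable [Semiring R]

/-- The factor `1 + ∑ H(b) t^b` of slope `s` of a Harder–Narasimhan product. -/
noncomputable def slopeFactor (θ : Fin r → ℝ) (H : DimVec r → R) (s : ℝ) :
    MvPowerSeries (Fin r) R :=
  1 + collectionSeries ({b | slope θ b = s}.indicator H)

theorem constantCoeff_slopeFactor (θ : Fin r → ℝ) (H : DimVec r → R) (s : ℝ) :
    constantCoeff (slopeFactor θ H s) = 1 := by
  rw [slopeFactor, map_add, map_one, constantCoeff_collectionSeries, add_zero]

theorem coeff_exponent_slopeFactor (θ : Fin r → ℝ) (H : DimVec r → R) (s : ℝ) (γ : DimVec r) :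
    coeff γ.exponent (slopeFactor θ H s) = {b | slope θ b = s}.indicator H γ := by
  classical
  rw [slopeFactor, map_add, coeff_one, if_neg γ.exponent_ne_zero, zero_add,
    coeff_exponent_collectionSeries]

open Classical in
theorem prod_map_slopeFactor (θ : Fin r → ℝ) (H : DimVec r → R) {L : List ℝ} (hL : L.Nodup) :
    (L.map (slopeFactor θ H)).prod = tupleSeries fun α =>
      if (α.map (slope θ)).Sublist L then (α.map H).prod else 0 := by
  induction L with
  | nil => rw [List.map_nil, List.prod_nil, tupleSeries_eq_one (by simp) (by simp)]
  | cons s L ih =>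
    obtain ⟨hs, hL⟩ := List.nodup_cons.mp hL
    rw [List.map_cons, List.prod_cons, ih hL, slopeFactor, add_mul, one_mul,
      collectionSeries_mul_tupleSeries, ← tupleSeries_add]
    congr 1
    funext α
    cases α with
    | nil => simp [consTuple]
    | cons b α =>
      have hexcl : ¬ (s :: α.map (slope θ)).Sublist L := fun hsub =>
        hs (hsub.subset List.mem_cons_self)
      simp only [Pi.add_apply, consTuple, List.map_cons, List.prod_cons, Set.indicator_apply,
        Set.mem_ofPred_eq, List.cons_sublist_cons']
      by_cases hb : slope θ b = s
      · simp only [hb, hexcl, if_false, if_true, zero_add, true_and, false_or, mul_ite, mul_zero]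
      · simp only [hb, if_false, zero_mul, add_zero, false_and, or_false]

end Semiring

variable [Ring R] [Algebra ℚ R]

theorem coeff_exponent_prod_map_slopeFactor {θ : Fin r → ℝ} {H : DimVec r → R} {L : List ℝ}
    (hL : L.SortedGT) (hH : ∀ b, slope θ b ∉ L → H b = 0) (γ : DimVec r) :
    coeff γ.exponent (L.map (slopeFactor θ H)).prod = act (hnCol θ) H γ := by
  classical
  rw [prod_map_slopeFactor θ H hL.nodup]
  refine Finset.sum_congr rfl fun α _ => ?_
  have hdecr : (α.map (slope θ)).SortedGT ↔ α.Pairwise fun a b => slope θ b < slope θ a := by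
    rw [List.sortedGT_iff_pairwise, List.pairwise_map]
  simp only [sublist_iff_of_sortedGT hL, hdecr, hnCol, ite_smul, one_smul, zero_smul]
  by_cases hα : α.map (slope θ) ⊆ L
  · simp only [hα, and_true]
  · obtain ⟨b, hb, hbL⟩ : ∃ b ∈ α, slope θ b ∉ L := by simpa [List.subset_def] using hα
    have hprod : (α.map H).prod = 0 := List.prod_eq_zero (List.mem_map.mpr ⟨b, hb, hH b hbL⟩)
    simp only [hprod, ite_self]

end SlopeFactors

section Logarithm

/-- The elements of slope `s`, together with zero. -/
def slopeSubmonoid (θ : Fin r → ℝ) (s : ℝ) : AddSubmonoid (Fin r → ℕ) where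
  carrier := {a | ∑ k, θ k * (a k : ℝ) = s * ∑ k, (a k : ℝ)}
  zero_mem' := by simp
  add_mem' {a b} ha hb := by
    simp only [Set.mem_ofPred_eq, Pi.add_apply, Nat.cast_add, mul_add,
      Finset.sum_add_distrib] at ha hb ⊢
    rw [ha, hb]

theorem mem_slopeSubmonoid {θ : Fin r → ℝ} {s : ℝ} {b : DimVec r} :
    b.1 ∈ slopeSubmonoid θ s ↔ slope θ b = s := by
  have hb : (b.size : ℝ) ≠ 0 := by exact_mod_cast b.size_pos.ne'
  rw [slope, div_eq_iff hb, size, Nat.cast_sum]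
  rfl

theorem slope_eq_of_mem_decomp {θ : Fin r → ℝ} {s : ℝ} {γ : DimVec r} {α : List (DimVec r)}
    (hα : α ∈ decomp γ) (hs : ∀ b ∈ α, slope θ b = s) : slope θ γ = s := by
  rw [← mem_slopeSubmonoid, ← mem_decomp.mp hα]
  refine AddSubmonoid.list_sum_mem _ fun a ha => ?_
  obtain ⟨b, hb, rfl⟩ := List.mem_map.mp ha
  exact mem_slopeSubmonoid.mpr (hs b hb)

theorem forall_slope_eq_iff {θ : Fin r → ℝ} {s : ℝ} {γ : DimVec r} {α : List (DimVec r)}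
    (hα : α ∈ decomp γ) :
    (∀ b ∈ α, slope θ b = s) ↔
      slope θ γ = s ∧ α.Pairwise fun a b => slope θ a = slope θ b := by
  refine ⟨fun hs => ⟨slope_eq_of_mem_decomp hα hs, List.pairwise_of_forall_mem_list
    fun a ha b hb => (hs a ha).trans (hs b hb).symm⟩, ?_⟩
  rintro ⟨rfl, hpw⟩ b hb
  refine (slope_eq_of_mem_decomp hα fun a ha => ?_).symm
  exact List.Pairwise.forall_of_forall_of_flip (R := fun a b => slope θ a = slope θ b)
    (fun _ _ => rfl) hpw (hpw.imp fun h => h.symm) ha hb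

theorem length_pos_of_mem_decomp {γ : DimVec r} {α : List (DimVec r)} (hα : α ∈ decomp γ) :
    0 < α.length := by
  refine List.length_pos_iff.mpr ?_
  rintro rfl
  exact γ.2 (mem_decomp.mp hα).symm

theorem length_le_size_of_mem_decomp {γ : DimVec r} {α : List (DimVec r)} (hα : α ∈ decomp γ) :
    α.length ≤ γ.size :=
  (length_le α).trans (sum_size_of_mem_decomp hα).le

variable [Ring R] [Algebra ℚ R]

theorem coeff_exponent_logSeries_one_add (H : DimVec r → R) (γ : DimVec r) :
    coeff γ.exponent (logSeries (1 + collectionSeries H)) =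
      ∑ α ∈ decomp γ, ((-1) ^ (α.length - 1) / (α.length : ℚ)) • (α.map H).prod := by
  simp only [coeff_logSeries, add_sub_cancel_left, collectionSeries_pow, coeff_tupleSeries,
    degree_exponent, Finset.smul_sum]
  rw [Finset.sum_comm]
  refine Finset.sum_congr rfl fun α hα => ?_
  have hpos := length_pos_of_mem_decomp hα
  have hle := length_le_size_of_mem_decomp hα
  rw [Finset.sum_eq_single_of_mem (α.length - 1) (Finset.mem_range.mpr (by omega)),
    Nat.sub_add_cancel hpos, if_pos rfl]
  intro n _ hn
  rw [if_neg (by omega), smul_zero]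

theorem coeff_exponent_logSeries_slopeFactor (θ : Fin r → ℝ) (H : DimVec r → R) (s : ℝ)
    (γ : DimVec r) :
    coeff γ.exponent (logSeries (slopeFactor θ H s)) =
      if slope θ γ = s then act (logCol θ) H γ else 0 := by
  classical
  have hterm : ∀ α ∈ decomp γ, (α.map ({b | slope θ b = s}.indicator H)).prod =
      if slope θ γ = s ∧ α.Pairwise (fun a b => slope θ a = slope θ b) then (α.map H).prod
      else 0 := fun α hα => by
    simp only [prod_map_indicator, Set.mem_ofPred_eq, forall_slope_eq_iff hα]
  rw [slopeFactor, coeff_exponent_logSeries_one_add,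
    Finset.sum_congr rfl fun α hα => by rw [hterm α hα]]
  split_ifs with hγ
  · simp only [act, logCol, hγ, true_and, ite_smul, zero_smul, smul_ite, smul_zero]
  · simp only [hγ, false_and, if_false, smul_zero, Finset.sum_const_zero]

end Logarithm

section Refinement

/-- `θ'` refines the weak stability `θ` on `T`. -/
def RefinesOn (T : Finset (DimVec r)) (θ θ' : Fin r → ℝ) : Prop :=
  ∀ a ∈ T, ∀ b ∈ T, slope θ b < slope θ a → slope θ' b < slope θ' a

theorem continuous_slope (a : DimVec r) : Continuous fun θ : Fin r → ℝ => slope θ a := by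
  unfold slope
  fun_prop

theorem eventually_refinesOn (T : Finset (DimVec r)) (θ : Fin r → ℝ) :
    ∀ᶠ θ' in 𝓝 θ, RefinesOn T θ θ' := by
  simp only [RefinesOn, Finset.eventually_all, eventually_imp_distrib_left]
  exact fun a _ b _ =>
    (continuous_slope b).continuousAt.eventually_lt (continuous_slope a).continuousAt

variable {T : Finset (DimVec r)} {θ θ' : Fin r → ℝ} {a b : DimVec r} {s t : ℝ}

theorem RefinesOn.slope_eq (h : RefinesOn T θ θ') (ha : a ∈ T) (hb : b ∈ T)
    (hab : slope θ' a = slope θ' b) : slope θ a = slope θ b :=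
  le_antisymm (not_lt.mp fun hlt => (h a ha b hb hlt).ne' hab)
    (not_lt.mp fun hlt => (h b hb a ha hlt).ne hab)

/-- The slopes of the elements of `T`, in decreasing order. -/
noncomputable def slopes (θ : Fin r → ℝ) (T : Finset (DimVec r)) : List ℝ :=
  (T.image (slope θ)).sort (· ≥ ·)

theorem mem_slopes : s ∈ slopes θ T ↔ ∃ b ∈ T, slope θ b = s := by
  rw [slopes, Finset.mem_sort, Finset.mem_image]

theorem sortedGT_slopes (θ : Fin r → ℝ) (T : Finset (DimVec r)) : (slopes θ T).SortedGT :=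
  Finset.sortedGT_sort _

/-- The elements of `T` of slope `s`. -/
noncomputable def slopeFiber (θ : Fin r → ℝ) (T : Finset (DimVec r)) (s : ℝ) :
    Finset (DimVec r) :=
  {b ∈ T | slope θ b = s}

theorem mem_slopeFiber : b ∈ slopeFiber θ T s ↔ b ∈ T ∧ slope θ b = s := Finset.mem_filter

theorem RefinesOn.slopes_eq_flatten (h : RefinesOn T θ θ') :
    slopes θ' T = ((slopes θ T).map fun s => slopes θ' (slopeFiber θ T s)).flatten := by
  refine (sortedGT_slopes θ' T).eq_of_mem_iff (List.sortedGT_iff_pairwise.mpr ?_) fun t => ?_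
  · rw [List.pairwise_flatten, List.pairwise_map, List.forall_mem_map]
    refine ⟨fun s _ => (sortedGT_slopes _ _).pairwise,
      (sortedGT_slopes θ T).pairwise.imp fun {s s'} hlt t ht t' ht' => ?_⟩
    obtain ⟨a, ha, rfl⟩ := mem_slopes.mp ht
    obtain ⟨b, hb, rfl⟩ := mem_slopes.mp ht'
    obtain ⟨haT, rfl⟩ := mem_slopeFiber.mp ha
    obtain ⟨hbT, rfl⟩ := mem_slopeFiber.mp hb
    exact h a haT b hbT hlt
  · simp only [List.mem_flatten, List.mem_map, mem_slopes]
    constructor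
    · rintro ⟨b, hb, rfl⟩
      refine ⟨_, ⟨slope θ b, ⟨b, hb, rfl⟩, rfl⟩, ?_⟩
      exact mem_slopes.mpr ⟨b, mem_slopeFiber.mpr ⟨hb, rfl⟩, rfl⟩
    · rintro ⟨-, ⟨s, -, rfl⟩, ht⟩
      obtain ⟨b, hb, rfl⟩ := mem_slopes.mp ht
      exact ⟨b, (mem_slopeFiber.mp hb).1, rfl⟩

section Semiring

variable [Semiring R]

/-- The Harder–Narasimhan product of the slope factors of `H`, over the slopes occurring in `T`
in decreasing order. -/
noncomputable def hnProd (θ : Fin r → ℝ) (H : DimVec r → R) (T : Finset (DimVec r)) :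
    MvPowerSeries (Fin r) R :=
  ((slopes θ T).map (slopeFactor θ H)).prod

theorem constantCoeff_hnProd (θ : Fin r → ℝ) (H : DimVec r → R) (T : Finset (DimVec r)) :
    constantCoeff (hnProd θ H T) = 1 := by
  rw [hnProd, map_list_prod, List.map_map]
  refine List.prod_eq_one fun x hx => ?_
  obtain ⟨s, -, rfl⟩ := List.mem_map.mp hx
  exact constantCoeff_slopeFactor θ H s

/-- The 1-collection whose slope factors for `θ` are the Harder–Narasimhan products for `θ'` of the
elements of `T` with the given `θ`-slope. -/
noncomputable def coarsen (θ θ' : Fin r → ℝ) (T : Finset (DimVec r)) (H : DimVec r → R)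
    (b : DimVec r) : R :=
  coeff b.exponent (hnProd θ' H (slopeFiber θ T (slope θ b)))

theorem coarsen_eq_zero (θ' : Fin r → ℝ) (H : DimVec r → R) (hb : slope θ b ∉ slopes θ T) :
    coarsen θ θ' T H b = 0 := by
  classical
  have hempty : slopeFiber θ T (slope θ b) = ∅ := Finset.filter_eq_empty_iff.mpr fun a ha hab =>
    hb (mem_slopes.mpr ⟨a, ha, hab⟩)
  rw [coarsen, hempty, hnProd, slopes, Finset.image_empty, Finset.sort_empty, List.map_nil,
    List.prod_nil, coeff_one, if_neg b.exponent_ne_zero]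

end Semiring

variable [Ring R] {H : DimVec r → R}

theorem RefinesOn.slopeFactor_mem_supportedSeries (h : RefinesOn T θ θ') (hH : ∀ b ∉ T, H b = 0)
    (ht : t ∈ slopes θ' (slopeFiber θ T s)) :
    slopeFactor θ' H t ∈ supportedSeries R (slopeSubmonoid θ s) := by
  classical
  refine add_mem (one_mem _) fun a ha => ?_
  obtain rfl | ⟨b, rfl⟩ := eq_zero_or_eq_exponent a
  · exact constantCoeff_collectionSeries _
  · obtain ⟨a, ha', rfl⟩ := mem_slopes.mp ht
    obtain ⟨haT, rfl⟩ := mem_slopeFiber.mp ha'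
    rw [coeff_exponent_collectionSeries, Set.indicator_apply_eq_zero]
    exact fun hb => hH b fun hbT => ha (mem_slopeSubmonoid.mpr (h.slope_eq hbT haT hb))

theorem RefinesOn.hnProd_mem_supportedSeries (h : RefinesOn T θ θ') (hH : ∀ b ∉ T, H b = 0)
    (s : ℝ) : hnProd θ' H (slopeFiber θ T s) ∈ supportedSeries R (slopeSubmonoid θ s) := by
  refine list_prod_mem (List.forall_mem_map.mpr fun t ht => ?_)
  exact h.slopeFactor_mem_supportedSeries hH ht

theorem RefinesOn.slopeFactor_coarsen (h : RefinesOn T θ θ') (hH : ∀ b ∉ T, H b = 0) (s : ℝ) :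
    slopeFactor θ (coarsen θ θ' T H) s = hnProd θ' H (slopeFiber θ T s) := by
  classical
  ext a
  obtain rfl | ⟨b, rfl⟩ := eq_zero_or_eq_exponent a
  · rw [coeff_zero_eq_constantCoeff_apply, coeff_zero_eq_constantCoeff_apply,
      constantCoeff_slopeFactor, constantCoeff_hnProd]
  rw [coeff_exponent_slopeFactor, Set.indicator_apply]
  split_ifs with hb
  · obtain rfl : slope θ b = s := hb
    rfl
  · exact (h.hnProd_mem_supportedSeries hH s _ (mt mem_slopeSubmonoid.mp hb)).symm

theorem RefinesOn.hnProd_coarsen (h : RefinesOn T θ θ') (hH : ∀ b ∉ T, H b = 0) :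
    hnProd θ (coarsen θ θ' T H) T = hnProd θ' H T := by
  rw [hnProd, hnProd, h.slopes_eq_flatten, List.map_flatten, List.prod_flatten, List.map_map,
    List.map_map, List.map_congr_left fun s _ => h.slopeFactor_coarsen hH s]
  rfl

/-- Both sides are coefficients of Harder–Narasimhan products, and the factors for `θ'` group into
those for `θ`. -/
theorem RefinesOn.act_hnCol_coarsen [Algebra ℚ R] (h : RefinesOn T θ θ')
    (hH : ∀ b ∉ T, H b = 0) :
    act (hnCol θ) (coarsen θ θ' T H) = act (hnCol θ') H := by
  funext γ
  rw [← coeff_exponent_prod_map_slopeFactor (sortedGT_slopes θ T)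
    fun b hb => coarsen_eq_zero θ' H hb]
  rw [← coeff_exponent_prod_map_slopeFactor (sortedGT_slopes θ' T)
    fun b hb => hH b fun hbT => hb (mem_slopes.mpr ⟨b, hbT, rfl⟩)]
  exact congrArg (coeff γ.exponent) (h.hnProd_coarsen hH)

end Refinement

section Locality

variable [Ring R] [Algebra ℚ R]

theorem act_congr (F : List (DimVec r) → ℚ) {H H' : DimVec r → R} {γ : DimVec r}
    (h : ∀ b ≤ γ, H b = H' b) : act F H γ = act F H' γ := by
  refine Finset.sum_congr rfl fun α hα => ?_
  rw [List.map_congr_left fun a ha => h a ((le_total ha).trans_eq (mem_decomp.mp hα))]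

theorem size_induction {P : DimVec r → Prop} (h : ∀ γ, (∀ b, b.size < γ.size → P b) → P γ)
    (γ : DimVec r) : P γ :=
  (measure (size (r := r))).wf.induction γ h

theorem stackyDT_eq_sub (A : DimVec r → R) (θ : Fin r → ℝ) (γ : DimVec r) :
    stackyDT A θ γ = A γ - ∑ α ∈ (decomp γ).filter (fun α => 2 ≤ α.length),
      hnCol θ α • (α.map (stackyDT A θ)).prod := by
  have h := congrFun (hnCol_act_stackyDT A θ) γ
  rw [act_hnCol_eq] at h
  exact eq_sub_of_add_eq h

theorem stackyDT_congr {A A' : DimVec r → R} (θ : Fin r → ℝ) {γ : DimVec r}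
    (h : ∀ b ≤ γ, A b = A' b) : stackyDT A θ γ = stackyDT A' θ γ := by
  induction γ using size_induction with
  | h γ ih =>
    rw [stackyDT_eq_sub, stackyDT_eq_sub, h γ le_rfl]
    congr 1
    refine Finset.sum_congr rfl fun α hα => ?_
    obtain ⟨hα, hlen⟩ := Finset.mem_filter.mp hα
    rw [List.map_congr_left fun a ha => ih a (size_lt_of_mem hα hlen ha) fun b hb =>
      h b (hb.trans ((le_total ha).trans_eq (mem_decomp.mp hα)))]

theorem stackyDT_mem (𝓡 : (Fin r → ℕ) → Submodule ℚ R) [SetLike.GradedMonoid 𝓡]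
    {A : DimVec r → R} (hA : ∀ b : DimVec r, A b ∈ 𝓡 b.1) (θ : Fin r → ℝ) (γ : DimVec r) :
    stackyDT A θ γ ∈ 𝓡 γ.1 := by
  induction γ using size_induction with
  | h γ ih =>
    rw [stackyDT_eq_sub]
    refine Submodule.sub_mem _ (hA γ) (Submodule.sum_mem _ fun α hα =>
      Submodule.smul_mem _ _ ?_)
    obtain ⟨hα, hlen⟩ := Finset.mem_filter.mp hα
    rw [← mem_decomp.mp hα, total]
    exact SetLike.list_prod_map_mem_graded α Subtype.val _ fun a ha =>
      ih a (size_lt_of_mem hα hlen ha)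

theorem RefinesOn.stackyDT_eq_coarsen {T : Finset (DimVec r)} {θ θ' : Fin r → ℝ}
    (h : RefinesOn T θ θ') (hT : IsLowerSet (T : Set (DimVec r))) (A : DimVec r → R)
    {γ : DimVec r} (hγ : γ ∈ T) :
    stackyDT A θ γ =
      coarsen θ θ' T ((T : Set (DimVec r)).indicator (stackyDT A θ')) γ := by
  set H := (T : Set (DimVec r)).indicator (stackyDT A θ')
  have hH : ∀ b ∉ T, H b = 0 := fun b hb => Set.indicator_of_notMem hb _
  have hHn : ∀ b ∈ T, act (hnCol θ) (coarsen θ θ' T H) b = A b := fun b hb => by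
    rw [h.act_hnCol_coarsen hH, ← congrFun (hnCol_act_stackyDT A θ') b]
    exact act_congr _ fun c hc => Set.indicator_of_mem (hT hc hb) _
  rw [stackyDT_unique _ (coarsen θ θ' T H) θ rfl]
  exact stackyDT_congr θ fun b hb => (hHn b (hT hb hγ)).symm

end Locality

section LocalConstancy

variable [Ring R]

theorem slopeFactor_mem_homogeneousSeries {S : Type*} [SetLike S R] [AddSubgroupClass S R]
    {𝓡 : (Fin r → ℕ) → S} [SetLike.GradedMonoid 𝓡] {H : DimVec r → R}
    (hH : ∀ b, H b ∈ 𝓡 b.1) (θ : Fin r → ℝ) (s : ℝ) :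
    slopeFactor θ H s ∈ homogeneousSeries 𝓡 := by
  classical
  intro a
  obtain rfl | ⟨b, rfl⟩ := eq_zero_or_eq_exponent a
  · rw [coeff_zero_eq_constantCoeff_apply, constantCoeff_slopeFactor, Finsupp.coe_zero]
    exact SetLike.one_mem_graded 𝓡
  · rw [coeff_exponent_slopeFactor, Set.indicator_apply]
    split_ifs
    exacts [hH b, zero_mem _]

theorem RefinesOn.slopeFactor_mem_homogeneousSeriesOn {S : Type*} [SetLike S R]
    [AddSubgroupClass S R] {𝓡 : (Fin r → ℕ) → S} [SetLike.GradedMonoid 𝓡] {H : DimVec r → R}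
    {T : Finset (DimVec r)} {θ θ' : Fin r → ℝ} {s t : ℝ} (h : RefinesOn T θ θ')
    (hH : ∀ b, H b ∈ 𝓡 b.1) (hHT : ∀ b ∉ T, H b = 0)
    (ht : t ∈ slopes θ' (slopeFiber θ T s)) :
    slopeFactor θ' H t ∈ homogeneousSeriesOn 𝓡 (slopeSubmonoid θ s) := by
  refine ⟨⟨slopeFactor_mem_homogeneousSeries hH θ' t,
    h.slopeFactor_mem_supportedSeries hHT ht⟩, ?_⟩
  change constantCoeff (slopeFactor θ' H t) ∈ Subring.center R
  rw [constantCoeff_slopeFactor]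
  exact one_mem _

variable [Algebra ℚ R]

theorem sum_coeff_logSeries_slopeFactor {θ : Fin r → ℝ} {T : Finset (DimVec r)} {γ : DimVec r}
    (hγ : γ ∈ T) (H : DimVec r → R) :
    ((slopes θ T).map fun t => coeff γ.exponent (logSeries (slopeFactor θ H t))).sum =
      act (logCol θ) H γ := by
  simp only [coeff_exponent_logSeries_slopeFactor]
  rw [← List.sum_toFinset _ (sortedGT_slopes θ T).nodup, Finset.sum_ite_eq,
    if_pos (List.mem_toFinset.mpr (mem_slopes.mpr ⟨γ, hγ, rfl⟩))]

theorem RefinesOn.rationalDT_eq {𝓡 : (Fin r → ℕ) → Submodule ℚ R} [SetLike.GradedMonoid 𝓡]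
    {A : DimVec r → R} (hA : ∀ b : DimVec r, A b ∈ 𝓡 b.1) {θ θ' : Fin r → ℝ} {γ : DimVec r}
    (h : RefinesOn (Finset.Iic γ) θ θ')
    (htr : IsTracialAt γ.exponent (homogeneousSeriesOn 𝓡 (slopeSubmonoid θ (slope θ γ)))) :
    rationalDT A θ' γ = rationalDT A θ γ := by
  set T := Finset.Iic γ
  have hγ : γ ∈ T := Finset.mem_Iic.mpr le_rfl
  have hT : IsLowerSet (T : Set (DimVec r)) := by
    rw [Finset.coe_Iic]
    exact isLowerSet_Iic γ
  set H := (T : Set (DimVec r)).indicator (stackyDT A θ')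
  have hHT : ∀ b ∉ T, H b = 0 := fun b hb => Set.indicator_of_notMem hb _
  have hH : ∀ b, H b ∈ 𝓡 b.1 := fun b => by
    obtain hb | hb : H b = 0 ∨ H b = stackyDT A θ' b := Set.indicator_eq_zero_or_self _ _ b
    · exact hb.symm ▸ zero_mem _
    · exact hb.symm ▸ stackyDT_mem 𝓡 hA θ' b
  set K := slopeFiber θ T (slope θ γ)
  calc rationalDT A θ' γ
      = act (logCol θ') H γ := act_congr _ fun b hb =>
        (Set.indicator_of_mem (hT hb hγ) (stackyDT A θ')).symm
    _ = ((slopes θ' K).map fun t => coeff γ.exponent (logSeries (slopeFactor θ' H t))).sum :=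
        (sum_coeff_logSeries_slopeFactor (mem_slopeFiber.mpr ⟨hγ, rfl⟩) H).symm
    _ = coeff γ.exponent (logSeries (hnProd θ' H K)) := by
        rw [hnProd, htr.coeff_logSeries_list_prod
          (List.forall_mem_map.mpr fun t ht => h.slopeFactor_mem_homogeneousSeriesOn hH hHT ht)
          (List.forall_mem_map.mpr fun t _ => constantCoeff_slopeFactor θ' H t), List.map_map]
        rfl
    _ = act (logCol θ) (coarsen θ θ' T H) γ := by
        rw [← h.slopeFactor_coarsen hHT, coeff_exponent_logSeries_slopeFactor, if_pos rfl]
    _ = rationalDT A θ γ := act_congr _ fun b hb => (h.stackyDT_eq_coarsen hT A (hT hb hγ)).symm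

end LocalConstancy

section SelfStability

variable {ω : (Fin r → ℤ) →ₗ[ℤ] (Fin r → ℤ) →ₗ[ℤ] ℝ}

theorem sum_selfStability_mul (γ : DimVec r) (a : Fin r → ℕ) :
    ∑ k, selfStability ω γ k * (a k : ℝ) = ω (toLattice a) (toLattice γ.1) := by
  have ha : toLattice a = ∑ k, (a k : ℤ) • Pi.single k (1 : ℤ) := by
    funext j
    simp [toLattice, Finset.sum_apply, Pi.single_apply]
  rw [ha, map_sum, LinearMap.sum_apply]
  refine Finset.sum_congr rfl fun k _ => ?_
  rw [map_smul, LinearMap.smul_apply, selfStability, zsmul_eq_mul, mul_comm, Int.cast_natCast]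

theorem slope_selfStability_eq_zero_iff {γ b : DimVec r} :
    slope (selfStability ω γ) b = 0 ↔ ω (toLattice b.1) (toLattice γ.1) = 0 := by
  have hb : (b.size : ℝ) ≠ 0 := by exact_mod_cast b.size_pos.ne'
  rw [slope, sum_selfStability_mul, div_eq_zero_iff, or_iff_left hb]

theorem slope_selfStability_self (hω : ∀ u v, ω u v = -ω v u) (γ : DimVec r) :
    slope (selfStability ω γ) γ = 0 :=
  slope_selfStability_eq_zero_iff.mpr (self_eq_neg.mp (hω _ _))

theorem pairing_eq_zero_of_slope_eq (hω : ∀ u v, ω u v = -ω v u) {γ b b' : DimVec r}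
    (hsum : b.1 + b'.1 = γ.1)
    (hb : slope (selfStability ω γ) b = slope (selfStability ω γ) γ) :
    ω (toLattice b.1) (toLattice b'.1) = 0 := by
  rw [slope_selfStability_self hω, slope_selfStability_eq_zero_iff] at hb
  have hγ : toLattice γ.1 = toLattice b.1 + toLattice b'.1 := by
    rw [← hsum]
    funext k
    exact Nat.cast_add _ _
  rwa [hγ, map_add, self_eq_neg.mp (hω (toLattice b.1) _), zero_add] at hb

theorem IsAttractorInvariant.attractorInvariant_eq [Ring R] [Algebra ℚ R] {A : DimVec r → R}
    {γ : DimVec r} {x : R} (h : IsAttractorInvariant A ω γ x) :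
    attractorInvariant A ω γ = x := by
  have hex : ∃ y, IsAttractorInvariant A ω γ y := ⟨x, h⟩
  rw [attractorInvariant, dif_pos hex]
  exact hex.choose_spec.unique h

end SelfStability

end DimVec

theorem mainTheorem4_general {r : ℕ} {R : Type*} [Ring R] [Algebra ℚ R]
    (𝓡 : (Fin r → ℕ) → Submodule ℚ R) [SetLike.GradedMonoid 𝓡]
    (A : DimVec r → R) (hA : ∀ β : DimVec r, A β ∈ 𝓡 β.1) (θ : Fin r → ℝ) (γ : DimVec r)
    (hcomm : ∀ β β' : DimVec r, β.1 + β'.1 = γ.1 → DimVec.slope θ β = DimVec.slope θ γ →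
      ∀ x ∈ 𝓡 β.1, ∀ y ∈ 𝓡 β'.1, x * y = y * x) :
    ∀ᶠ θ' in 𝓝 θ, DimVec.rationalDT A θ' γ = DimVec.rationalDT A θ γ := by
  filter_upwards [DimVec.eventually_refinesOn (Finset.Iic γ) θ] with θ' hθ'
  refine hθ'.rationalDT_eq hA (isTracialAt_homogeneousSeriesOn fun a b hab ha hb haP _ => ?_)
  obtain ⟨β, rfl⟩ := (DimVec.eq_zero_or_eq_exponent a).resolve_left ha
  obtain ⟨β', rfl⟩ := (DimVec.eq_zero_or_eq_exponent b).resolve_left hb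
  exact hcomm β β' (congrArg DFunLike.coe hab) (DimVec.mem_slopeSubmonoid.mp haP)

theorem mainTheorem4 {r : ℕ} {R : Type*} [Ring R] [Algebra ℚ R]
    (𝓡 : (Fin r → ℕ) → Submodule ℚ R) [GradedAlgebra 𝓡]
    (ω : (Fin r → ℤ) →ₗ[ℤ] (Fin r → ℤ) →ₗ[ℤ] ℝ)
    (hω : ∀ u v, ω u v = -ω v u)
    (hcomm : ∀ β β' : Fin r → ℕ, ω (DimVec.toLattice β) (DimVec.toLattice β') = 0 →
      ∀ x ∈ 𝓡 β, ∀ y ∈ 𝓡 β', x * y = y * x)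
    (A : DimVec r → R) (hA : ∀ β : DimVec r, A β ∈ 𝓡 β.1)
    (γ : DimVec r) :
    DimVec.IsAttractorInvariant A ω γ (DimVec.attractorInvariant A ω γ) ∧
      DimVec.attractorInvariant A ω γ =
        DimVec.rationalDT A (DimVec.selfStability ω γ) γ := by
  have h : DimVec.IsAttractorInvariant A ω γ (DimVec.rationalDT A (DimVec.selfStability ω γ) γ) :=
    (mainTheorem4_general 𝓡 A hA _ γ fun β β' hsum hβ =>
      hcomm _ _ (DimVec.pairing_eq_zero_of_slope_eq hω hsum hβ)).mono fun _ hθ' _ => hθ'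
  exact ⟨h.attractorInvariant_eq ▸ h, h.attractorInvariant_eq⟩
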